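/- Bytes are elements $(b_0,\dots,b_7)$ of $\mathbb F_2^8$. Identify $(b_0,\dots,b_7)$ with $\sum_i b_i x^i$ in the field $\mathbb F_{256}=\mathbb F_2[x]/(x^8+x^4+x^3+x+1)$. Let $\gamma\in\mathrm{Sym}(\mathbb F_2^8)$ be the AES S-box: inversion in $\mathbb F_{256}$ (with $0\mapsto 0$) followed by the affine map $b\mapsto b'$, $b'_i=b_i+b_{i+4}+b_{i+5}+b_{i+6}+b_{i+7}+c_i$ (indices modulo $8$), with $(c_0,\dots,c_7)=(1,1,0,0,0,1,1,0)$. Let $V=(\mathbb F_2^8)^4=\mathbb F_2^{32}$ and let $\rho_{\mathrm{AES}}\in\mathrm{Sym}(V)$ be $$(a_0,a_1,a_2,a_3)\mapsto(\gamma(a_1),\gamma(a_2),\gamma(a_3),\gamma(a_0)),$$ that is, RotWord followed by $\gamma$ on each byte. Let $\overline{\rho_{\mathrm{AES}}}\in\mathrm{Sym}(V^4)$, $V^4=\mathbb F_2^{128}$, be the map $$(v_1,v_2,v_3,v_4)\mapsto(v_1+r,\;v_1+v_2+r,\;v_1+v_2+v_3+r,\;v_1+v_2+v_3+v_4+r),\qquad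 r=\rho_{\mathrm{AES}}(v_4).$$ Let $\sigma_w$ denote the translation $x\mapsto x+w$ of $V^4$ and $T_{128}=\{\sigma_w\mid w\in V^4\}$. The AES-128 key-schedule round transformation with round constant $rc\in\mathbb F_2^8$ is $\overline{\rho_{\mathrm{AES}}}$ followed by $\sigma_{(\overline{rc},\overline{rc},\overline{rc},\overline{rc})}$, where $\overline{rc}=(rc,0,0,0)\in V$. Then the group $\Gamma_{\mathrm{AES}}=\langle\overline{\rho_{\mathrm{AES}}},T_{128}\rangle\le\mathrm{Sym}(\mathbb F_2^{128})$ is primitive. It is also the group generated by $T_{128}$ together with the AES-128 key-schedule round transformations for all $rc\in\mathbb F_2^8$, and the group generated by the maps "$\overline{\rho_{\mathrm{AES}}}$ followed by $\sigma_w$", $w\in V^4$. Consequently no linear partition is invariant under it: for no subspace $\{0\}\ne U\ne\mathbb F_2^{128}$ does every element of $\Gamma_{\mathrm{AES}}$ map each coset of $U$ to a coset of $U$. -/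

import Mathlib

namespace AES128

open Polynomial in
/-- The AES polynomial `X ^ 8 + X ^ 4 + X ^ 3 + X + 1` over the field with two elements. -/
noncomputable def aesPoly : (ZMod 2)[X] := X ^ 8 + X ^ 4 + X ^ 3 + X + 1

open Polynomial in
theorem aesPoly_natDegree : aesPoly.natDegree = 8 := by
  unfold aesPoly; compute_degree!

open Polynomial in
theorem aesPoly_monic : aesPoly.Monic := by
  unfold aesPoly; monicity!

open Polynomial in
theorem aesPoly_coeff (k : ℕ) : aesPoly.coeff k =
    if k = 0 ∨ k = 1 ∨ k = 3 ∨ k = 4 ∨ k = 8 then 1 else 0 := by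
  simp only [aesPoly, coeff_add, coeff_X_pow, coeff_X, coeff_one]
  rcases Nat.lt_or_ge k 9 with h | h
  · interval_cases k <;> simp
  · have h0 : k ≠ 0 := by omega
    have h1 : ¬ (1 = k) := by omega
    have h1' : k ≠ 1 := by omega
    have h3 : k ≠ 3 := by omega
    have h4 : k ≠ 4 := by omega
    have h8 : k ≠ 8 := by omega
    simp [h0, h1, h1', h3, h4, h8]

open Polynomial in
theorem aesPoly_irreducible : Irreducible aesPoly := by
  have h1 : aesPoly ≠ 1 := by
    intro h
    have := aesPoly_natDegree
    rw [h] at this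
    simp at this
  refine aesPoly_monic.irreducible_iff_natDegree'.2 ⟨h1, ?_⟩
  intro f g hf hg hfg hmem
  have hsum : f.natDegree + g.natDegree = 8 := by
    rw [← hf.natDegree_mul hg, hfg, aesPoly_natDegree]
  rw [aesPoly_natDegree, Finset.mem_Ioc] at hmem
  have hc : ∀ k, (f * g).coeff k = if k = 0 ∨ k = 1 ∨ k = 3 ∨ k = 4 ∨ k = 8 then 1 else 0 := by
    intro k; rw [hfg, aesPoly_coeff]
  have hfl : f.coeff f.natDegree = 1 := hf
  have hgl : g.coeff g.natDegree = 1 := hg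
  have hfz : ∀ k, f.natDegree < k → f.coeff k = 0 := fun k hk => coeff_eq_zero_of_natDegree_lt hk
  have hgz : ∀ k, g.natDegree < k → g.coeff k = 0 := fun k hk => coeff_eq_zero_of_natDegree_lt hk
  have e0 : (f * g).coeff 0 = 1 := by rw [hc]; simp
  have e1 : (f * g).coeff 1 = 1 := by rw [hc]; simp
  have e2 : (f * g).coeff 2 = 0 := by rw [hc]; simp
  have e3 : (f * g).coeff 3 = 1 := by rw [hc]; simp
  have e4 : (f * g).coeff 4 = 1 := by rw [hc]; simp
  have e5 : (f * g).coeff 5 = 0 := by rw [hc]; simp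
  have e6 : (f * g).coeff 6 = 0 := by rw [hc]; simp
  have e7 : (f * g).coeff 7 = 0 := by rw [hc]; simp
  simp only [coeff_mul, Finset.Nat.antidiagonal_succ, Finset.Nat.antidiagonal_zero,
    Finset.sum_cons, Finset.map_singleton, Finset.sum_singleton, Finset.map_cons,
    Function.Embedding.prodMap, Function.Embedding.coeFn_mk, Prod.map,
    Function.Embedding.refl_apply] at e0 e1 e2 e3 e4 e5 e6 e7
  obtain ⟨hlo, hhi⟩ := hmem
  have hg4 : g.natDegree = 1 ∨ g.natDegree = 2 ∨ g.natDegree = 3 ∨ g.natDegree = 4 := by omega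
  rcases hg4 with hd | hd | hd | hd
  · have hd' : f.natDegree = 7 := by omega
    rw [hd] at hgl hgz
    rw [hd'] at hfl hfz
    have z2 := hgz 2 (by omega)
    have z3 := hgz 3 (by omega)
    have z4 := hgz 4 (by omega)
    have z5 := hgz 5 (by omega)
    have z6 := hgz 6 (by omega)
    have z7 := hgz 7 (by omega)
    simp only [hgl, hfl, z2, z3, z4, z5, z6, z7, mul_zero, mul_one, one_mul,
      zero_add] at e0 e1 e2 e3 e4 e5 e6 e7
    generalize f.coeff 0 = a0 at e0 e1 e2 e3 e4 e5 e6 e7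
    generalize f.coeff 1 = a1 at e0 e1 e2 e3 e4 e5 e6 e7
    generalize f.coeff 2 = a2 at e0 e1 e2 e3 e4 e5 e6 e7
    generalize f.coeff 3 = a3 at e0 e1 e2 e3 e4 e5 e6 e7
    generalize f.coeff 4 = a4 at e0 e1 e2 e3 e4 e5 e6 e7
    generalize f.coeff 5 = a5 at e0 e1 e2 e3 e4 e5 e6 e7
    generalize f.coeff 6 = a6 at e0 e1 e2 e3 e4 e5 e6 e7
    generalize g.coeff 0 = b0 at e0 e1 e2 e3 e4 e5 e6 e7
    clear * - e0 e1 e2 e3 e4 e5 e6 e7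
    revert e0 e1 e2 e3 e4 e5 e6 e7
    decide +revert
  · have hd' : f.natDegree = 6 := by omega
    rw [hd] at hgl hgz
    rw [hd'] at hfl hfz
    have z3 := hgz 3 (by omega)
    have z4 := hgz 4 (by omega)
    have z5 := hgz 5 (by omega)
    have z6 := hgz 6 (by omega)
    have z7 := hgz 7 (by omega)
    have y7 := hfz 7 (by omega)
    simp only [hgl, hfl, z3, z4, z5, z6, z7, y7, mul_zero, zero_mul, mul_one, one_mul,
      zero_add, add_zero] at e0 e1 e2 e3 e4 e5 e6 e7
    generalize f.coeff 0 = a0 at e0 e1 e2 e3 e4 e5 e6 e7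
    generalize f.coeff 1 = a1 at e0 e1 e2 e3 e4 e5 e6 e7
    generalize f.coeff 2 = a2 at e0 e1 e2 e3 e4 e5 e6 e7
    generalize f.coeff 3 = a3 at e0 e1 e2 e3 e4 e5 e6 e7
    generalize f.coeff 4 = a4 at e0 e1 e2 e3 e4 e5 e6 e7
    generalize f.coeff 5 = a5 at e0 e1 e2 e3 e4 e5 e6 e7
    generalize g.coeff 0 = b0 at e0 e1 e2 e3 e4 e5 e6 e7
    generalize g.coeff 1 = b1 at e0 e1 e2 e3 e4 e5 e6 e7
    clear * - e0 e1 e2 e3 e4 e5 e6 e7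
    revert e0 e1 e2 e3 e4 e5 e6 e7
    decide +revert
  · have hd' : f.natDegree = 5 := by omega
    rw [hd] at hgl hgz
    rw [hd'] at hfl hfz
    have z4 := hgz 4 (by omega)
    have z5 := hgz 5 (by omega)
    have z6 := hgz 6 (by omega)
    have z7 := hgz 7 (by omega)
    have y6 := hfz 6 (by omega)
    have y7 := hfz 7 (by omega)
    simp only [hgl, hfl, z4, z5, z6, z7, y6, y7, mul_zero, zero_mul, mul_one, one_mul,
      zero_add, add_zero] at e0 e1 e2 e3 e4 e5 e6 e7
    generalize f.coeff 0 = a0 at e0 e1 e2 e3 e4 e5 e6 e7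
    generalize f.coeff 1 = a1 at e0 e1 e2 e3 e4 e5 e6 e7
    generalize f.coeff 2 = a2 at e0 e1 e2 e3 e4 e5 e6 e7
    generalize f.coeff 3 = a3 at e0 e1 e2 e3 e4 e5 e6 e7
    generalize f.coeff 4 = a4 at e0 e1 e2 e3 e4 e5 e6 e7
    generalize g.coeff 0 = b0 at e0 e1 e2 e3 e4 e5 e6 e7
    generalize g.coeff 1 = b1 at e0 e1 e2 e3 e4 e5 e6 e7
    generalize g.coeff 2 = b2 at e0 e1 e2 e3 e4 e5 e6 e7
    clear * - e0 e1 e2 e3 e4 e5 e6 e7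
    revert e0 e1 e2 e3 e4 e5 e6 e7
    decide +revert
  · have hd' : f.natDegree = 4 := by omega
    rw [hd] at hgl hgz
    rw [hd'] at hfl hfz
    have z5 := hgz 5 (by omega)
    have z6 := hgz 6 (by omega)
    have z7 := hgz 7 (by omega)
    have y5 := hfz 5 (by omega)
    have y6 := hfz 6 (by omega)
    have y7 := hfz 7 (by omega)
    simp only [hgl, hfl, z5, z6, z7, y5, y6, y7, mul_zero, zero_mul, mul_one, one_mul,
      zero_add, add_zero] at e0 e1 e2 e3 e4 e5 e6 e7
    generalize f.coeff 0 = a0 at e0 e1 e2 e3 e4 e5 e6 e7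
    generalize f.coeff 1 = a1 at e0 e1 e2 e3 e4 e5 e6 e7
    generalize f.coeff 2 = a2 at e0 e1 e2 e3 e4 e5 e6 e7
    generalize f.coeff 3 = a3 at e0 e1 e2 e3 e4 e5 e6 e7
    generalize g.coeff 0 = b0 at e0 e1 e2 e3 e4 e5 e6 e7
    generalize g.coeff 1 = b1 at e0 e1 e2 e3 e4 e5 e6 e7
    generalize g.coeff 2 = b2 at e0 e1 e2 e3 e4 e5 e6 e7
    generalize g.coeff 3 = b3 at e0 e1 e2 e3 e4 e5 e6 e7
    clear * - e0 e1 e2 e3 e4 e5 e6 e7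
    revert e0 e1 e2 e3 e4 e5 e6 e7
    decide +revert

instance : Fact (Irreducible aesPoly) := ⟨aesPoly_irreducible⟩

/-- The field with `256` elements of the AES specification,
`F₂[X] / (X ^ 8 + X ^ 4 + X ^ 3 + X + 1)`. -/
abbrev GF256 : Type := AdjoinRoot aesPoly

/-- Bytes, i.e. `F₂ ^ 8`; the coordinate `i` is the bit of weight `2 ^ i`. -/
abbrev Byte : Type := Fin 8 → ZMod 2

/-- The space `V = F₂ ^ 32` of words of four bytes. -/
abbrev Word : Type := Fin 4 → Byte

/-- The key space `V ^ 4 = F₂ ^ 128`: four words of four bytes. -/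
abbrev Key : Type := Fin 4 → Word

/-- The basis `1, x, …, x ^ 7` of `GF256`, where `x` is the class of `X`. -/
noncomputable def gfBasis : Module.Basis (Fin 8) (ZMod 2) GF256 :=
  (AdjoinRoot.powerBasis' aesPoly_monic).basis.reindex (finCongr aesPoly_natDegree)

theorem gfBasis_apply (i : Fin 8) : gfBasis i = AdjoinRoot.root aesPoly ^ (i : ℕ) := by
  simp only [gfBasis, Module.Basis.reindex_apply, PowerBasis.coe_basis,
    AdjoinRoot.powerBasis'_gen]
  rfl

/-- The byte `(b₀, …, b₇)` read as the field element `b₀ + b₁ x + ⋯ + b₇ x ^ 7`. -/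
noncomputable def byteToField : Byte ≃ GF256 := gfBasis.equivFun.symm.toEquiv

theorem byteToField_apply (b : Byte) :
    byteToField b = ∑ i, b i • AdjoinRoot.root aesPoly ^ (i : ℕ) := by
  simp [byteToField, Module.Basis.equivFun_symm_apply, gfBasis_apply]

/-- The affine part of the AES S-box (indices modulo `8`); its constant is `0x63`. -/
def sboxAffine : Equiv.Perm Byte where
  toFun b i := b i + b (i + 4) + b (i + 5) + b (i + 6) + b (i + 7) +
    (![1, 1, 0, 0, 0, 1, 1, 0] : Byte) i
  invFun b i := b (i + 2) + b (i + 5) + b (i + 7) + (![1, 0, 1, 0, 0, 0, 0, 0] : Byte) i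
  left_inv b := by
    funext i
    fin_cases i <;> simp <;>
    · generalize b 0 = b0, b 1 = b1, b 2 = b2, b 3 = b3, b 4 = b4, b 5 = b5, b 6 = b6, b 7 = b7
      clear * -
      decide +revert
  right_inv b := by
    funext i
    fin_cases i <;> simp <;>
    · generalize b 0 = b0, b 1 = b1, b 2 = b2, b 3 = b3, b 4 = b4, b 5 = b5, b 6 = b6, b 7 = b7
      clear * -
      decide +revert

/-- The AES S-box `γ` (`SubBytes` on one byte): the field inversion, with `0 ↦ 0`, followed by
the affine map. -/
noncomputable def sbox : Equiv.Perm Byte :=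
  ((byteToField.trans (Equiv.inv GF256)).trans byteToField.symm).trans sboxAffine

/-- The map `λ` (`RotWord`): `(a₀, a₁, a₂, a₃) ↦ (a₁, a₂, a₃, a₀)`. -/
def rotWord : Equiv.Perm Word where
  toFun w i := w (i + 1)
  invFun w i := w (i - 1)
  left_inv w := by funext i; simp
  right_inv w := by funext i; simp

/-- The map `γ'`: the S-box applied to each of the four bytes of a word. -/
noncomputable def subWord : Equiv.Perm Word := Equiv.piCongrRight fun _ => sbox

/-- The permutation `ρ_AES` of `V`: first `RotWord`, then the S-box on each byte. -/
noncomputable def rhoAES : Equiv.Perm Word := rotWord.trans subWord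

/-- The AES-like key-schedule operator on `V ^ 4` induced by a permutation `ρ` of `V`. -/
def keyScheduleOp {V : Type*} [AddCommGroup V] (ρ : Equiv.Perm V) :
    Equiv.Perm (Fin 4 → V) where
  toFun v := ![v 0 + ρ (v 3), v 0 + v 1 + ρ (v 3), v 0 + v 1 + v 2 + ρ (v 3),
    v 0 + v 1 + v 2 + v 3 + ρ (v 3)]
  invFun v := ![v 0 - ρ (v 3 - v 2), v 1 - v 0, v 2 - v 1, v 3 - v 2]
  left_inv v := by
    funext i
    fin_cases i <;> simp
  right_inv v := by
    funext i
    fin_cases i <;> simp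

/-- The translation `σ_v : x ↦ x + v`. -/
def translation {M : Type*} [AddCommGroup M] (v : M) : Equiv.Perm M := Equiv.addRight v

/-- The translation group of `M`, as a subgroup of the symmetric group. -/
def translationGroup (M : Type*) [AddCommGroup M] : Subgroup (Equiv.Perm M) where
  carrier := Set.range translation
  one_mem' := ⟨0, by ext x; simp [translation]⟩
  mul_mem' := by
    rintro _ _ ⟨v, rfl⟩ ⟨w, rfl⟩
    exact ⟨w + v, by ext x; simp [translation, add_assoc]⟩
  inv_mem' := by
    rintro _ ⟨v, rfl⟩
    exact ⟨-v, by ext x; simp [translation]⟩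

/-- The AES-128 key-schedule round transformation with round constant `rc`: the operator induced
by `ρ_AES`, followed by the addition of `(rc, 0, 0, 0)` to each of the four words. -/
noncomputable def keyScheduleRound (rc : Byte) : Equiv.Perm Key :=
  (keyScheduleOp rhoAES).trans (translation fun _ => ![rc, 0, 0, 0])

/-- The group generated by the operator induced by `ρ_AES` and all translations of `F₂ ^ 128`. -/
noncomputable def keyScheduleGroup : Subgroup (Equiv.Perm Key) :=
  Subgroup.closure ({keyScheduleOp rhoAES} ∪ (translationGroup Key : Set (Equiv.Perm Key)))

/-- The partition of a vector space over `F₂` into the cosets of a subspace. -/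
def cosetPartition {M : Type*} [AddCommGroup M] [Module (ZMod 2) M] (U : Submodule (ZMod 2) M) :
    Set (Set M) :=
  Set.range fun v : M => {x | ∃ u ∈ U, x = u + v}

/-- A partition `P` is invariant under a permutation group `G` if each element of `G` sends each
part of `P` to a part of `P`. -/
def IsInvariantPartition {M : Type*} (G : Subgroup (Equiv.Perm M)) (P : Set (Set M)) : Prop :=
  ∀ g ∈ G, ∀ B ∈ P, g '' B ∈ P

end AES128

/-!
Blocks of a group containing all translations of an `F₂`-space are the cosets of a subspace `U`,
so primitivity, and the absence of invariant linear partitions, both amount to the following: if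
`keyScheduleOp rhoAES (x + u) - keyScheduleOp rhoAES x ∈ U` for all `x` and all `u ∈ U`, then
`U` is `⊥` or `⊤` (`eq_bot_or_eq_top_of_stable`).

If the last word of every `u ∈ U` vanishes, then `U` is stable under the linear part `L` of the
operator (`partialSums`), `L` is a single unipotent Jordan block on the word index, and iterating
`L` on `u` forces `u = 0`. Otherwise some `u ∈ U` has a nonzero byte `a` in its last word. Letting
only the byte of `x` in that position vary and subtracting two of the resulting differences
cancels `L u`, and shows that `U` contains the constant vectors of words supported on one byte
whose value is a difference of two values of the derivative `b ↦ sbox (b + a) - sbox b`. These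
values span the space of bytes (`byte_eq_top_of_sbox_derivative_mem`), so `U` contains all
constant vectors supported on that byte. Because of `rotWord`, the same argument moves on to the
next byte, and `U` contains all constant vectors, hence is `L`-stable, and the images of the
constant vectors under powers of `L` span everything.

The spanning property of the S-box comes from a statement on the inversion of a finite field `K`
of characteristic two (`addSubgroup_eq_top_of_inv_derivative_mem`). After scaling, the
derivative takes the values `1` and `(z ^ 2 + z)⁻¹`, so an additive subgroup `S ≠ ⊤` containing
the differences of those values, and containing `1`, contains the inverses of the elements of the
index-two subgroup `T = {z ^ 2 + z}`. By counting, `S` is the set of these inverses. Computing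
the inverse of `t⁻¹ + (t + c)⁻¹` then shows that `T` is closed under division, and a proper
subgroup of index two in a field with more than four elements cannot be. That `1 ∈ S` follows from
a primitive cube root of unity in `T`, that is, from an element with `z ^ 4 + z + 1 = 0`.
-/

open AES128

/-! ### Inversion in finite fields of characteristic two -/

section InvDerivative

variable {K : Type*} [Field K]

/-- A subgroup of index two in a field with more than four elements is not closed under division:
it meets each of its multiples `k • T` nontrivially, so it would contain every `k`. -/
theorem exists_div_notMem_of_two_mul_card [Finite K] (hK : 4 < Nat.card K) {T : AddSubgroup K}
    (hT : 2 * Nat.card T = Nat.card K) : ∃ s ∈ T, ∃ t ∈ T, t ≠ 0 ∧ s / t ∉ T := by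
  by_contra! hdiv
  have htop : T = ⊤ := by
    refine (AddSubgroup.eq_top_iff' T).2 fun k => ?_
    let f : T × T → K := fun p => p.1 - k * p.2
    have hf : ¬ Function.Injective f := fun hinj => by
      have hle := Nat.card_le_card_of_injective f hinj
      rw [Nat.card_prod] at hle
      nlinarith
    simp only [Function.Injective, not_forall] at hf
    obtain ⟨⟨⟨s, hs⟩, ⟨t, ht⟩⟩, ⟨⟨s', hs'⟩, ⟨t', ht'⟩⟩, heq, hne⟩ := hf
    have hsub : s - k * t = s' - k * t' := heq
    replace heq : s - s' = k * (t - t') := by linear_combination hsub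
    have htt : t - t' ≠ 0 := fun h0 => by
      rw [h0, mul_zero] at heq
      exact hne (by simp [sub_eq_zero.1 h0, sub_eq_zero.1 heq])
    have := hdiv _ (T.sub_mem hs hs') _ (T.sub_mem ht ht') htt
    rwa [heq, mul_div_cancel_right₀ _ htt] at this
  rw [htop, AddSubgroup.card_top] at hT
  omega

variable [CharP K 2]

/-- The Artin–Schreier map `z ↦ z ^ 2 + z` in characteristic two. -/
def artinSchreier (K : Type*) [Field K] [CharP K 2] : K →+ K where
  toFun z := z ^ 2 + z
  map_zero' := by simp
  map_add' x y := by rw [CharTwo.add_sq]; ring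

theorem artinSchreier_apply (z : K) : artinSchreier K z = z ^ 2 + z := rfl

theorem artinSchreier_eq_zero_iff {z : K} : artinSchreier K z = 0 ↔ z = 0 ∨ z = 1 := by
  rw [artinSchreier_apply, show z ^ 2 + z = z * (z + 1) by ring, mul_eq_zero, CharTwo.add_eq_zero]

theorem card_artinSchreier_range [Finite K] :
    2 * Nat.card (artinSchreier K).range = Nat.card K := by
  have hker : Nat.card (artinSchreier K).ker = 2 := by
    have h : ((artinSchreier K).ker : Set K) = {0, 1} := by
      ext z
      simp [AddMonoidHom.mem_ker, artinSchreier_eq_zero_iff]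
    change Nat.card ((artinSchreier K).ker : Set K) = 2
    rw [h, Nat.card_coe_set_eq, Set.ncard_pair zero_ne_one]
  rw [← AddSubgroup.index_ker, ← hker, AddSubgroup.card_mul_index]

/-- The inverses of the elements of the range `T` of the Artin–Schreier map generate the field:
a proper subgroup `S` containing them would consist of them, by counting, and then `T` would be
closed under division. -/
theorem addSubgroup_eq_top_of_inv_artinSchreier_mem [Finite K] (hK : 4 < Nat.card K)
    {S : AddSubgroup K} (h : ∀ z, (artinSchreier K z)⁻¹ ∈ S) : S = ⊤ := by
  by_contra hS
  set T := (artinSchreier K).range with hTdef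
  have hT : 2 * Nat.card T = Nat.card K := card_artinSchreier_range
  have hsub : (fun x : K => x⁻¹) '' (T : Set K) ⊆ S := by
    rintro _ ⟨_, ⟨z, rfl⟩, rfl⟩
    exact h z
  have hcard : (S : Set K).ncard ≤ ((fun x : K => x⁻¹) '' (T : Set K)).ncard := by
    rw [Set.ncard_image_of_injective _ inv_injective]
    have h1 := AddSubgroup.one_lt_index_of_ne_top hS
    have h2 := S.card_mul_index
    have h3 : Nat.card S ≤ Nat.card T := by nlinarith
    exact h3
  have hST := Set.eq_of_subset_of_ncard_le hsub hcard
  have hinv : ∀ s ∈ S, s⁻¹ ∈ T := fun s hs => by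
    have : s ∈ (fun x : K => x⁻¹) '' (T : Set K) := hST ▸ hs
    obtain ⟨t, ht, rfl⟩ := this
    simpa using ht
  have hmem : ∀ t ∈ T, t⁻¹ ∈ S := fun t ht => hsub ⟨t, ht, rfl⟩
  have hsq : ∀ t ∈ T, ∀ c ∈ T, c ≠ 0 → t ^ 2 / c ∈ T := fun t ht c hc hc0 => by
    by_cases ht0 : t = 0
    · simp [ht0, T.zero_mem]
    by_cases htc : t + c = 0
    · rw [CharTwo.add_eq_zero] at htc
      rwa [htc, sq, mul_div_assoc, div_self hc0, mul_one]
    -- the inverse of `t⁻¹ + (t + c)⁻¹ = c / (t * (t + c))` is `t ^ 2 / c + t`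
    have key := T.sub_mem (hinv _ (S.add_mem (hmem t ht) (hmem _ (T.add_mem ht hc)))) ht
    convert key using 1
    have h2 : (2 : K) = 0 := CharTwo.two_eq_zero
    have hden : t⁻¹ + (t + c)⁻¹ = c / (t * (t + c)) := by
      field_simp
      linear_combination t * h2
    rw [hden, inv_div]
    field_simp
    ring
  obtain ⟨_, ⟨z, rfl⟩, c, hc, hc0, hnot⟩ := exists_div_notMem_of_two_mul_card hK hT
  have : Fintype K := Fintype.ofFinite K
  -- every element of `T` is the square of an element of `T`, as squaring is onto and commutes with
  -- the Artin–Schreier map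
  obtain ⟨y, rfl⟩ : ∃ y : K, y ^ 2 = z :=
    (FiniteField.isSquare_of_char_two (ringChar.eq K 2 ▸ rfl) z).imp fun y hy => by rw [hy, sq]
  refine hnot ?_
  have := hsq _ ⟨y, rfl⟩ c hc hc0
  rwa [artinSchreier_apply, CharTwo.add_sq] at this

/-- The differences of the values of a derivative of the inversion generate the field. -/
theorem addSubgroup_eq_top_of_inv_derivative_mem [Finite K] (hK : 4 < Nat.card K)
    {z : K} (hz : z ^ 4 + z + 1 = 0) {S : AddSubgroup K} {a : K} (ha : a ≠ 0)
    (h : ∀ x y, ((x + a)⁻¹ - x⁻¹) - ((y + a)⁻¹ - y⁻¹) ∈ S) : S = ⊤ := by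
  have h2 : (2 : K) = 0 := CharTwo.two_eq_zero
  -- the subgroup `a • S` satisfies the hypothesis with `a = 1`
  set R : AddSubgroup K := S.comap (AddMonoidHom.mulLeft a⁻¹) with hR
  have hmem : ∀ x, artinSchreier K x ≠ 0 → (artinSchreier K x)⁻¹ + 1 ∈ R := fun x hx => by
    have h0 : x ≠ 0 := fun h0 => hx (artinSchreier_eq_zero_iff.2 (Or.inl h0))
    have h1 : x + 1 ≠ 0 := fun h1 =>
      hx (artinSchreier_eq_zero_iff.2 (Or.inr (CharTwo.add_eq_zero.1 h1)))
    have hS := h (a * x) 0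
    have e : a * x + a = a * (x + 1) := by ring
    rw [e, mul_inv, mul_inv, zero_add, inv_zero, sub_zero, ← mul_sub, ← mul_sub_one] at hS
    have e2 : (artinSchreier K x)⁻¹ + 1 = (x + 1)⁻¹ - x⁻¹ - 1 := by
      rw [artinSchreier_apply, show x ^ 2 + x = x * (x + 1) by ring]
      field_simp
      linear_combination (1 + x * (x + 1)) * h2
    rw [hR, AddSubgroup.mem_comap, e2]
    exact hS
  -- `w = z ^ 2 + z` and `w + 1` are the primitive cube roots of unity, and both lie in the range
  -- of the Artin–Schreier map
  have hw : artinSchreier K (artinSchreier K z) = 1 := by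
    simp only [artinSchreier_apply]
    linear_combination hz + (z ^ 3 + z ^ 2 - 1) * h2
  set w := artinSchreier K z with hwdef
  have hww : artinSchreier K (z + w) = w + 1 := by rw [map_add, hw]
  have hrel : w ^ 2 + w = 1 := hw
  have hw0 : w ≠ 0 := fun h0 => by simp [h0] at hrel
  have hw1 : w + 1 ≠ 0 := fun h1 => by
    rw [show w ^ 2 + w = w * (w + 1) by ring, h1, mul_zero] at hrel
    exact zero_ne_one hrel
  have hprod : w * (w + 1) = 1 := by linear_combination hrel
  have hone : (1 : K) ∈ R := by
    have m1 := hmem z hw0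
    have m2 := hmem (z + w) (by rwa [hww])
    rw [← hwdef, inv_eq_of_mul_eq_one_right hprod] at m1
    rw [hww, inv_eq_of_mul_eq_one_left hprod] at m2
    convert R.add_mem m1 m2 using 1
    linear_combination (-1 - w) * h2
  have htop : R = ⊤ := addSubgroup_eq_top_of_inv_artinSchreier_mem hK fun x => by
    by_cases hx : artinSchreier K x = 0
    · rw [hx, inv_zero]
      exact R.zero_mem
    · simpa using R.sub_mem (hmem x hx) hone
  refine (AddSubgroup.eq_top_iff' S).2 fun x => ?_
  have : a * x ∈ R := htop ▸ AddSubgroup.mem_top _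
  simpa [hR, inv_mul_cancel_left₀ ha] using this

end InvDerivative

namespace AES128

/-! ### The S-box -/

instance : CharP GF256 2 := charP_of_injective_algebraMap (algebraMap (ZMod 2) GF256).injective 2

instance : Finite GF256 := Finite.of_equiv _ byteToField

theorem card_GF256 : Nat.card GF256 = 256 := by
  rw [← Nat.card_congr byteToField, Nat.card_eq_fintype_card]
  simp

open Polynomial in
theorem root_aesPoly_eq_zero :
    AdjoinRoot.root aesPoly ^ 8 + AdjoinRoot.root aesPoly ^ 4 + AdjoinRoot.root aesPoly ^ 3 +
      AdjoinRoot.root aesPoly + 1 = 0 := by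
  have h : ∀ x : GF256, (X ^ 8 + X ^ 4 + X ^ 3 + X + 1 : (ZMod 2)[X]).eval₂
      (AdjoinRoot.of aesPoly) x = x ^ 8 + x ^ 4 + x ^ 3 + x + 1 := fun x => by
    simp only [eval₂_add, eval₂_X_pow, eval₂_X, eval₂_one]
  exact (h _).symm.trans (AdjoinRoot.eval₂_root aesPoly)

/-- `GF256` contains the field with `16` elements, generated by the element `0x5C` of order
`15`. -/
theorem exists_pow_four_add_self_add_one_eq_zero : ∃ z : GF256, z ^ 4 + z + 1 = 0 := by
  have h := root_aesPoly_eq_zero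
  have h2 : (2 : GF256) = 0 := CharTwo.two_eq_zero
  generalize AdjoinRoot.root aesPoly = x at h
  -- the square of `0x5C` is `0xE0`, whose square is `0x5D`
  have e1 : (x ^ 2 + x ^ 3 + x ^ 4 + x ^ 6) ^ 2 = x ^ 5 + x ^ 6 + x ^ 7 := by
    linear_combination x ^ 4 * h + (x ^ 6 + x ^ 8 + x ^ 9 + x ^ 10) * h2
  have e2 : (x ^ 5 + x ^ 6 + x ^ 7) ^ 2 = 1 + x ^ 2 + x ^ 3 + x ^ 4 + x ^ 6 := by
    linear_combination (1 + x + x ^ 4 + x ^ 6) * h + (-1 - x - x ^ 2 - x ^ 3 - 2 * x ^ 4 - x ^ 5 -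
      x ^ 6 - x ^ 7 - x ^ 8 - x ^ 9 + x ^ 11 + x ^ 12 + x ^ 13) * h2
  refine ⟨x ^ 2 + x ^ 3 + x ^ 4 + x ^ 6, ?_⟩
  rw [show 4 = 2 * 2 from rfl, pow_mul, e1, e2]
  linear_combination (1 + x ^ 2 + x ^ 3 + x ^ 4 + x ^ 6) * h2

/-- The linear part of `sboxAffine`. -/
def sboxLinear : Byte →ₗ[ZMod 2] Byte where
  toFun b i := b i + b (i + 4) + b (i + 5) + b (i + 6) + b (i + 7)
  map_add' b c := by funext i; simp only [Pi.add_apply]; ring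
  map_smul' r b := by
    funext i
    simp only [Pi.smul_apply, smul_eq_mul, RingHom.id_apply]
    ring

theorem sboxAffine_apply (b : Byte) :
    sboxAffine b = sboxLinear b + ![1, 1, 0, 0, 0, 1, 1, 0] := rfl

theorem sboxLinear_surjective : Function.Surjective sboxLinear := fun b => by
  obtain ⟨c, hc⟩ := sboxAffine.surjective (b + ![1, 1, 0, 0, 0, 1, 1, 0])
  exact ⟨c, add_right_cancel ((sboxAffine_apply c).symm.trans hc)⟩

theorem byteToField_add (b c : Byte) : byteToField (b + c) = byteToField b + byteToField c :=
  map_add gfBasis.equivFun.symm b c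

/-- The S-box is an affine function of the inverse in `GF256`. -/
theorem sbox_apply (b : Byte) :
    sbox b = (sboxLinear ∘ₗ gfBasis.equivFun.toLinearMap) (byteToField b)⁻¹ +
      ![1, 1, 0, 0, 0, 1, 1, 0] := rfl

/-- The differences of the values of a derivative of the S-box span the space of bytes. -/
theorem byte_eq_top_of_sbox_derivative_mem {S : Submodule (ZMod 2) Byte} {a : Byte} (ha : a ≠ 0)
    (h : ∀ b c, (sbox (b + a) - sbox b) - (sbox (c + a) - sbox c) ∈ S) : S = ⊤ := by
  set M := sboxLinear ∘ₗ gfBasis.equivFun.toLinearMap with hM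
  have hMsurj : Function.Surjective M :=
    sboxLinear_surjective.comp gfBasis.equivFun.surjective
  have ha' : byteToField a ≠ 0 := fun h0 =>
    ha (byteToField.injective (h0.trans (map_zero gfBasis.equivFun.symm).symm))
  obtain ⟨z, hz⟩ := exists_pow_four_add_self_add_one_eq_zero
  have htop : (S.comap M).toAddSubgroup = ⊤ := by
    refine addSubgroup_eq_top_of_inv_derivative_mem (by rw [card_GF256]; norm_num) hz ha'
      fun x y => ?_
    obtain ⟨b, rfl⟩ := byteToField.surjective x
    obtain ⟨c, rfl⟩ := byteToField.surjective y
    have hS := h b c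
    simp only [sbox_apply, byteToField_add, add_sub_add_right_eq_sub, ← map_sub] at hS
    exact hS
  refine (Submodule.eq_top_iff').2 fun b => ?_
  obtain ⟨x, rfl⟩ := hMsurj b
  have : x ∈ (S.comap M).toAddSubgroup := htop ▸ AddSubgroup.mem_top x
  exact this

/-! ### Stable subspaces of key-schedule operators -/

section KeyScheduleOp

variable {V : Type*} [AddCommGroup V]

/-- The linear part of a key-schedule operator: the partial sums of the words. -/
def partialSums (v : Fin 4 → V) : Fin 4 → V :=
  ![v 0, v 0 + v 1, v 0 + v 1 + v 2, v 0 + v 1 + v 2 + v 3]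

theorem keyScheduleOp_eq (ρ : Equiv.Perm V) (v : Fin 4 → V) :
    keyScheduleOp ρ v = partialSums v + fun _ => ρ (v 3) := by
  funext i
  fin_cases i <;> simp [keyScheduleOp, partialSums]

theorem keyScheduleOp_add_sub (ρ : Equiv.Perm V) (x u : Fin 4 → V) :
    keyScheduleOp ρ (x + u) - keyScheduleOp ρ x =
      partialSums u + fun _ => ρ (x 3 + u 3) - ρ (x 3) := by
  simp only [keyScheduleOp_eq]
  funext i
  fin_cases i <;> simp [partialSums] <;> abel

variable [Module (ZMod 2) V]

theorem add_self_eq_zero_of_module (v : V) : v + v = 0 := by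
  rw [← two_smul (ZMod 2) v, show (2 : ZMod 2) = 0 from rfl, zero_smul]

theorem eq_bot_of_partialSums_mem {U : Submodule (ZMod 2) (Fin 4 → V)}
    (h : ∀ u ∈ U, partialSums u ∈ U) (h3 : ∀ u ∈ U, u 3 = 0) : U = ⊥ := by
  refine (Submodule.eq_bot_iff U).2 fun u hu => ?_
  have c := h3 u hu
  have e1 := h3 _ (h _ hu)
  have e2 := h3 _ (h _ (h _ hu))
  have e3 := h3 _ (h _ (h _ (h _ hu)))
  have z := add_self_eq_zero_of_module (V := V)
  simp only [partialSums, Matrix.cons_val, c, add_zero] at e1 e2 e3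
  simp only [e1, add_zero] at e2 e3
  rw [← add_assoc, z, zero_add] at e2
  simp only [e2, add_zero, z] at e3
  simp only [e2, e3, zero_add] at e1
  funext i
  fin_cases i
  exacts [e3, e2, e1, c]

theorem eq_top_of_partialSums_mem {U : Submodule (ZMod 2) (Fin 4 → V)}
    (h : ∀ u ∈ U, partialSums u ∈ U) (hc : ∀ v : V, (fun _ => v) ∈ U) : U = ⊤ := by
  have z := add_self_eq_zero_of_module (V := V)
  -- the images of a constant vector under the powers of `partialSums`
  have m1 : ∀ v : V, ![v, 0, v, 0] ∈ U := fun v => by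
    convert h _ (hc v) using 1
    simp [partialSums, z]
  have m2 : ∀ v : V, ![v, v, 0, 0] ∈ U := fun v => by
    convert h _ (m1 v) using 1
    simp [partialSums, z]
  have m3 : ∀ v : V, ![v, 0, 0, 0] ∈ U := fun v => by
    convert h _ (m2 v) using 1
    simp [partialSums, z]
  refine (Submodule.eq_top_iff').2 fun u => ?_
  have hu : u = (fun _ => u 3) + ![u 2 + u 3, 0, u 2 + u 3, 0] + ![u 1 + u 3, u 1 + u 3, 0, 0] +
      ![u 0 + u 1 + u 2 + u 3, 0, 0, 0] := by
    funext i
    fin_cases i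
    · change u 0 = u 3 + (u 2 + u 3) + (u 1 + u 3) + (u 0 + u 1 + u 2 + u 3)
      linear_combination (norm := abel) -z (u 1) - z (u 2) - z (u 3) - z (u 3)
    · change u 1 = u 3 + 0 + (u 1 + u 3) + 0
      linear_combination (norm := abel) -z (u 3)
    · change u 2 = u 3 + (u 2 + u 3) + 0 + 0
      linear_combination (norm := abel) -z (u 3)
    · change u 3 = u 3 + 0 + 0 + 0
      abel
  rw [hu]
  exact U.add_mem (U.add_mem (U.add_mem (hc _) (m1 _)) (m2 _)) (m3 _)

end KeyScheduleOp

theorem rhoAES_apply (w : Word) (i : Fin 4) : rhoAES w i = sbox (w (i + 1)) := rfl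

/-- A byte of `a` at position `i + 1` which is nonzero yields, through `RotWord`, all words
supported on the byte `i`. -/
theorem single_mem_of_rhoAES_derivative_mem {W : Submodule (ZMod 2) Word} {a : Word} {i : Fin 4}
    (ha : a (i + 1) ≠ 0)
    (h : ∀ x y, (rhoAES (x + a) - rhoAES x) - (rhoAES (y + a) - rhoAES y) ∈ W) (b : Byte) :
    Pi.single i b ∈ W := by
  have htop : W.comap (LinearMap.single (ZMod 2) (fun _ : Fin 4 => Byte) i) = ⊤ := by
    refine byte_eq_top_of_sbox_derivative_mem ha fun b c => ?_
    rw [Submodule.mem_comap]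
    convert h (Pi.single (i + 1) b) (Pi.single (i + 1) c) using 1
    funext j
    by_cases hj : j = i
    · subst hj
      simp [rhoAES_apply]
    · have hj' : j + 1 ≠ i + 1 := fun e => hj (add_right_cancel e)
      simp [rhoAES_apply, hj, hj']
  have : b ∈ W.comap (LinearMap.single (ZMod 2) (fun _ : Fin 4 => Byte) i) := htop ▸ trivial
  exact this

/-- The only subspaces whose cosets are permuted by the AES key-schedule operator are the trivial
ones. -/
theorem eq_bot_or_eq_top_of_stable {U : Submodule (ZMod 2) Key}
    (h : ∀ x, ∀ u ∈ U, keyScheduleOp rhoAES (x + u) - keyScheduleOp rhoAES x ∈ U) :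
    U = ⊥ ∨ U = ⊤ := by
  simp only [keyScheduleOp_add_sub] at h
  by_cases h3 : ∀ u ∈ U, u 3 = 0
  · refine Or.inl (eq_bot_of_partialSums_mem (fun u hu => ?_) h3)
    have h0 := h 0 u hu
    simp only [h3 u hu, add_zero, sub_self] at h0
    simpa using (add_zero (partialSums u)) ▸ h0
  · push Not at h3
    obtain ⟨u, hu, hu3⟩ := h3
    let W : Submodule (ZMod 2) Word := U.comap (LinearMap.pi fun _ => LinearMap.id)
    have hderiv : ∀ u ∈ U, ∀ x y : Word,
        (rhoAES (x + u 3) - rhoAES x) - (rhoAES (y + u 3) - rhoAES y) ∈ W := fun u hu x y => by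
      have := U.sub_mem (h (fun _ => x) u hu) (h (fun _ => y) u hu)
      rw [add_sub_add_left_eq_sub] at this
      exact this
    have hstep : ∀ i : Fin 4, (∀ b, Pi.single (i + 1) b ∈ W) → ∀ b, Pi.single i b ∈ W :=
      fun i hi b => single_mem_of_rhoAES_derivative_mem (a := Pi.single (i + 1) 1) (by simp)
        (hderiv (fun _ => Pi.single (i + 1) 1) (hi 1)) b
    obtain ⟨j, hj⟩ := Function.ne_iff.1 hu3
    have hj1 : ∀ b, Pi.single (j - 1) b ∈ W :=
      single_mem_of_rhoAES_derivative_mem (by simpa using hj) (hderiv u hu)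
    have hsingle : ∀ i b, Pi.single i b ∈ W := by
      have hj2 := hstep (j - 1 - 1) (by simpa only [sub_add_cancel] using hj1)
      have hj3 := hstep (j - 1 - 1 - 1) (by simpa only [sub_add_cancel] using hj2)
      have hj4 := hstep (j - 1 - 1 - 1 - 1) (by simpa only [sub_add_cancel] using hj3)
      have hcover : ∀ i j : Fin 4, i = j - 1 ∨ i = j - 1 - 1 ∨ i = j - 1 - 1 - 1 ∨
          i = j - 1 - 1 - 1 - 1 := by decide
      intro i
      rcases hcover i j with rfl | rfl | rfl | rfl
      exacts [hj1, hj2, hj3, hj4]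
    have hW : ∀ w, w ∈ W := fun w => by
      rw [← Finset.univ_sum_single w]
      exact W.sum_mem fun i _ => hsingle i _
    refine Or.inr (eq_top_of_partialSums_mem (fun u hu => ?_) hW)
    have hc : (fun _ => rhoAES (0 + u 3) - rhoAES 0) ∈ U := hW _
    simpa only [Pi.zero_apply, add_sub_cancel_right] using U.sub_mem (h 0 u hu) hc

/-! ### Groups generated by the key schedule and the translations -/

theorem trans_translation {M : Type*} [AddCommGroup M] (g : Equiv.Perm M) (v : M) :
    g.trans (translation v) = translation v * g := rfl

theorem translation_mem_translationGroup {M : Type*} [AddCommGroup M] (v : M) :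
    translation v ∈ translationGroup M := ⟨v, rfl⟩

theorem keyScheduleOp_mem : keyScheduleOp rhoAES ∈ keyScheduleGroup :=
  Subgroup.subset_closure (Or.inl rfl)

theorem translation_mem (v : Key) : translation v ∈ keyScheduleGroup :=
  Subgroup.subset_closure (Or.inr (translation_mem_translationGroup v))

theorem keyScheduleGroup_eq_closure_keyScheduleRound :
    keyScheduleGroup = Subgroup.closure
      (Set.range keyScheduleRound ∪ (translationGroup Key : Set (Equiv.Perm Key))) := by
  apply le_antisymm
  · refine (Subgroup.closure_le _).2 (Set.union_subset ?_ ?_)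
    · have hround := Subgroup.subset_closure (k := Set.range keyScheduleRound ∪
        (translationGroup Key : Set (Equiv.Perm Key))) (Or.inl ⟨0, rfl⟩)
      have htr := Subgroup.subset_closure (k := Set.range keyScheduleRound ∪
        (translationGroup Key : Set (Equiv.Perm Key)))
        (Or.inr (translation_mem_translationGroup fun _ => ![0, 0, 0, 0]))
      rintro _ rfl
      simpa [keyScheduleRound, trans_translation] using
        Subgroup.mul_mem _ (Subgroup.inv_mem _ htr) hround
    · exact fun g hg => Subgroup.subset_closure (Or.inr hg)
  · refine (Subgroup.closure_le _).2 (Set.union_subset ?_ ?_)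
    · rintro _ ⟨rc, rfl⟩
      exact mul_mem (translation_mem _) keyScheduleOp_mem
    · exact fun g hg => Subgroup.subset_closure (Or.inr hg)

theorem keyScheduleGroup_eq_closure_trans_translation :
    keyScheduleGroup = Subgroup.closure
      (Set.range fun v : Key => (keyScheduleOp rhoAES).trans (translation v)) := by
  apply le_antisymm
  · have hmem : ∀ v, translation v * keyScheduleOp rhoAES ∈ Subgroup.closure
        (Set.range fun v : Key => (keyScheduleOp rhoAES).trans (translation v)) :=
      fun v => Subgroup.subset_closure ⟨v, rfl⟩
    have hop := hmem 0
    have h0 : translation (0 : Key) = 1 := Equiv.ext fun x => add_zero x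
    rw [h0, one_mul] at hop
    refine (Subgroup.closure_le _).2 (Set.union_subset (Set.singleton_subset_iff.2 hop) ?_)
    rintro _ ⟨v, rfl⟩
    simpa using Subgroup.mul_mem _ (hmem v) (Subgroup.inv_mem _ hop)
  · refine (Subgroup.closure_le _).2 ?_
    rintro _ ⟨v, rfl⟩
    exact mul_mem (translation_mem _) keyScheduleOp_mem

/-! ### Blocks of groups containing the translations -/

section Blocks

variable {M : Type*} [AddCommGroup M] {G : Subgroup (Equiv.Perm M)}

open scoped Pointwise in
/-- If `B` is a block containing `0` of a group containing the translations, then the image of a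
translate of `B` is a translate of `B`. -/
theorem apply_add_sub_apply_mem_of_isBlock (hG : ∀ v, translation v ∈ G) {B : Set M}
    (hB : MulAction.IsBlock G B) (h0 : 0 ∈ B) {g : Equiv.Perm M} (hg : g ∈ G) (x : M) {u : M}
    (hu : u ∈ B) : g (x + u) - g x ∈ B := by
  let k : G := ⟨translation (-g x), hG _⟩ * ⟨g, hg⟩ * ⟨translation x, hG _⟩
  have hk : ∀ y, k • y = g (x + y) - g x := fun y => by
    change g (y + x) + -g x = _
    rw [add_comm y, sub_eq_add_neg]
  have hk0 : k • (0 : M) ∈ B := by rwa [hk, add_zero, sub_self]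
  have hkB : k • B = B := hB.smul_eq_of_mem h0 hk0
  rw [← hk]
  exact hkB.subset (Set.smul_mem_smul_set hu)

variable [Module (ZMod 2) M]

open scoped Pointwise in
theorem exists_submodule_coe_eq_of_isBlock (hG : ∀ v, translation v ∈ G) {B : Set M}
    (hB : MulAction.IsBlock G B) (h0 : 0 ∈ B) : ∃ U : Submodule (ZMod 2) M, (U : Set M) = B := by
  have hsub : ∀ u ∈ B, ∀ v ∈ B, u + v ∈ B := fun u hu v hv => by
    -- the translation by `v` maps `0` to `v`, hence `B` to itself
    let k : G := ⟨translation v, hG v⟩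
    have hk0 : k • (0 : M) ∈ B := by
      change 0 + v ∈ B
      rwa [zero_add]
    have hkB : k • B = B := hB.smul_eq_of_mem h0 hk0
    exact hkB.subset (Set.smul_mem_smul_set hu)
  refine ⟨AddSubgroup.toZModSubmodule 2
    { carrier := B, zero_mem' := h0, add_mem' := fun hu hv => hsub _ hu _ hv,
      neg_mem' := fun {u} hu => ?_ }, ?_⟩
  · rwa [neg_eq_of_add_eq_zero_left (add_self_eq_zero_of_module u)]
  · simp

theorem apply_add_sub_apply_mem_of_isInvariantPartition {U : Submodule (ZMod 2) M}
    (hU : IsInvariantPartition G (cosetPartition U)) {g : Equiv.Perm M} (hg : g ∈ G) (x : M)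
    {u : M} (hu : u ∈ U) : g (x + u) - g x ∈ U := by
  obtain ⟨v, hv⟩ := hU g hg _ ⟨x, rfl⟩
  have hmem : ∀ y ∈ U, ∃ w ∈ U, g (x + y) = w + v := fun y hy => by
    have : g (x + y) ∈ g '' {z | ∃ u ∈ U, z = u + x} := ⟨x + y, ⟨y, hy, add_comm _ _⟩, rfl⟩
    rw [← hv] at this
    exact this
  obtain ⟨w, hw, e⟩ := hmem u hu
  obtain ⟨w', hw', e'⟩ := hmem 0 U.zero_mem
  rw [add_zero] at e'
  rw [e, e', add_sub_add_right_eq_sub]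
  exact U.sub_mem hw hw'

end Blocks

theorem isPreprimitive_keyScheduleGroup : MulAction.IsPreprimitive keyScheduleGroup Key := by
  have : MulAction.IsPretransitive keyScheduleGroup Key :=
    ⟨fun x y => ⟨⟨translation (y - x), translation_mem _⟩, add_sub_cancel x y⟩⟩
  refine MulAction.IsPreprimitive.of_isTrivialBlock_base 0 fun {B} h0 hB => ?_
  obtain ⟨U, rfl⟩ := exists_submodule_coe_eq_of_isBlock translation_mem hB h0
  rcases eq_bot_or_eq_top_of_stable fun x u hu =>
    apply_add_sub_apply_mem_of_isBlock translation_mem hB h0 keyScheduleOp_mem x hu with rfl | rfl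
  · exact Or.inl (by simp)
  · exact Or.inr (by simp)

end AES128

open AES128 in
theorem corollary3p4 :
    MulAction.IsPreprimitive keyScheduleGroup Key ∧
    keyScheduleGroup = Subgroup.closure
      (Set.range keyScheduleRound ∪ (translationGroup Key : Set (Equiv.Perm Key))) ∧
    keyScheduleGroup = Subgroup.closure
      (Set.range fun v : Key => (keyScheduleOp rhoAES).trans (translation v)) ∧
    ∀ U : Submodule (ZMod 2) Key, U ≠ ⊥ → U ≠ ⊤ →
      ¬ IsInvariantPartition keyScheduleGroup (cosetPartition U) := by
  refine ⟨isPreprimitive_keyScheduleGroup, keyScheduleGroup_eq_closure_keyScheduleRound,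
    keyScheduleGroup_eq_closure_trans_translation, fun U hbot htop hU => ?_⟩
  exact (eq_bot_or_eq_top_of_stable fun x u hu =>
    apply_add_sub_apply_mem_of_isInvariantPartition hU keyScheduleOp_mem x hu).elim hbot htop
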